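/- Let $\mathcal H_1,\mathcal H_2$ be separable complex Hilbert spaces and let $\rho$ be a state (a positive trace class operator of trace one) on the Hilbert space tensor product $\mathcal H_1\otimes\mathcal H_2$. A \emph{source-operator} $T_{122}$ for $\rho$ is a self-adjoint trace class operator on $\mathcal H_1\otimes\mathcal H_2\otimes\mathcal H_2$ whose partial trace over the second tensor factor and whose partial trace over the third tensor factor are both equal to $\rho$; a \emph{source-operator} $T_{112}$ for $\rho$ is a self-adjoint trace class operator on $\mathcal H_1\otimes\mathcal H_1\otimes\mathcal H_2$ whose partial trace over the first tensor factor and whose partial trace over the second tensor factor are both equal to $\rho$. Write $\|T\|_1=\mathrm{tr}\,|T|$ for the trace norm. Let $A_1,A_2$ be bounded self-adjoint operators on $\mathcal H_1$ and $B_1,B_2$ bounded self-adjoint operators on $\mathcal H_2$, all with operator norm $\le 1$, and let $\gamma_{nm}$, $n,m=1,2$, be real numbers with $|\gamma_{nm}|\le 1$. (a) If $\gamma_{11}\gamma_{12}=-\gamma_{21}\gamma_{22}$, then for every source-operator $T_{122}$ for $\rho$ $$\Big|\sum_{n,m=1,2}\gamma_{nm}\,\mathrm{tr}[\rho(A_n\otimes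 B_m)]\Big|\le 2\|T_{122}\|_1 .$$ (b) If $\gamma_{11}\gamma_{21}=-\gamma_{12}\gamma_{22}$, then for every source-operator $T_{112}$ for $\rho$ $$\Big|\sum_{n,m=1,2}\gamma_{nm}\,\mathrm{tr}[\rho(A_n\otimes B_m)]\Big|\le 2\|T_{112}\|_1 .$$ -/

import Mathlib

open scoped InnerProductSpace TensorProduct

noncomputable section

namespace Bipartite

section Trace

variable {H : Type*} [NormedAddCommGroup H] [InnerProductSpace ℂ H] [CompleteSpace H]

variable (H) in
/-- The index set of a fixed orthonormal basis of the complex Hilbert space `H`. -/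
def basisIndex : Set H := (exists_hilbertBasis ℂ H).choose

variable (H) in
/-- A fixed orthonormal (Hilbert) basis of the complex Hilbert space `H`. -/
def basis : HilbertBasis (basisIndex H) ℂ H := (exists_hilbertBasis ℂ H).choose_spec.choose

/-- `T` is trace class: `∑ i, ⟪e i, |T| e i⟫ < ∞`, where `|T| = (T* T) ^ (1/2)`.
The terms are nonnegative, and the sum does not depend on the orthonormal basis. -/
def IsTraceClass (T : H →L[ℂ] H) : Prop :=
  Summable fun i : basisIndex H => (⟪basis H i, CFC.abs T (basis H i)⟫_ℂ).re

/-- The trace norm `‖T‖₁ = tr |T|` of a trace class operator. -/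
def traceNorm (T : H →L[ℂ] H) : ℝ :=
  ∑' i : basisIndex H, (⟪basis H i, CFC.abs T (basis H i)⟫_ℂ).re

/-- The trace `tr T = ∑ i, ⟪e i, T e i⟫` of a trace class operator (the sum converges absolutely
and does not depend on the orthonormal basis). -/
def trace (T : H →L[ℂ] H) : ℂ :=
  ∑' i : basisIndex H, ⟪basis H i, T (basis H i)⟫_ℂ

/-- A (normal) quantum state: a positive trace class operator of trace one. -/
structure IsState (ρ : H →L[ℂ] H) : Prop where
  isPositive : ρ.IsPositive
  isTraceClass : IsTraceClass ρ
  trace_eq_one : trace ρ = 1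

end Trace

section Tensor

variable (H K : Type*) [NormedAddCommGroup H] [InnerProductSpace ℂ H]
  [NormedAddCommGroup K] [InnerProductSpace ℂ K]

/-- The Hilbert space tensor product: the completion of the algebraic tensor product for the inner
product with `⟪x ⊗ y, x' ⊗ y'⟫ = ⟪x, x'⟫ * ⟪y, y'⟫`. -/
abbrev HTensor : Type _ := UniformSpace.Completion (H ⊗[ℂ] K)

variable {H K} {H' K' : Type*} [NormedAddCommGroup H'] [InnerProductSpace ℂ H']
  [NormedAddCommGroup K'] [InnerProductSpace ℂ K']

/-- The bounded operator `A ⊗ B`, with `(A ⊗ B) (x ⊗ y) = A x ⊗ B y`. -/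
def opTensor (A : H →L[ℂ] H') (B : K →L[ℂ] K') : HTensor H K →L[ℂ] HTensor H' K' :=
  (TensorProduct.mapL A B).completion

variable (K) in
/-- The bounded operator `y ↦ x ⊗ y`. -/
def tensorLeft (x : H) : K →L[ℂ] HTensor H K :=
  UniformSpace.Completion.toComplL ∘L TensorProduct.mkL ℂ H K x

variable (H) in
/-- The bounded operator `x ↦ x ⊗ y`. -/
def tensorRight (y : K) : H →L[ℂ] HTensor H K :=
  UniformSpace.Completion.toComplL ∘L (TensorProduct.mkL ℂ H K).flip y

end Tensor

section PartialTrace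

variable {H K : Type*} [NormedAddCommGroup H] [InnerProductSpace ℂ H] [CompleteSpace H]
  [NormedAddCommGroup K] [InnerProductSpace ℂ K] [CompleteSpace K]

/-- `∑ i, (V i)* T (V i)`, the operator `R` with `⟪x, R y⟫ = ∑ i, ⟪V i x, T (V i y)⟫`. It is a
partial trace of `T` if `V i` inserts the `i`-th vector of an orthonormal basis of one tensor factor
at its place in the tensor product. For such `V i` and a trace class operator `T` the series
converges absolutely in trace norm, hence in operator norm. -/
def sliceSum {ι : Type*} (V : ι → H →L[ℂ] K) (T : K →L[ℂ] K) : H →L[ℂ] H :=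
  ∑' i, (V i).adjoint ∘L T ∘L V i

end PartialTrace

section SourceOperators

variable (H₁ H₂ : Type*) [NormedAddCommGroup H₁] [InnerProductSpace ℂ H₁] [CompleteSpace H₁]
  [NormedAddCommGroup H₂] [InnerProductSpace ℂ H₂] [CompleteSpace H₂]

/-- The Hilbert space `H₁ ⊗ H₁ ⊗ H₂`. -/
abbrev K112 : Type _ := HTensor H₁ (HTensor H₁ H₂)

/-- The Hilbert space `H₁ ⊗ H₂ ⊗ H₂`. -/
abbrev K122 : Type _ := HTensor (HTensor H₁ H₂) H₂

variable {H₁ H₂}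

/-- The partial trace over the first factor of `H₁ ⊗ H₁ ⊗ H₂`,
built from the maps `x ⊗ y ↦ e i ⊗ x ⊗ y`. -/
def ptrace112First (T : K112 H₁ H₂ →L[ℂ] K112 H₁ H₂) : HTensor H₁ H₂ →L[ℂ] HTensor H₁ H₂ :=
  sliceSum (fun i => tensorLeft (HTensor H₁ H₂) (basis H₁ i)) T

/-- The partial trace over the second factor of `H₁ ⊗ H₁ ⊗ H₂`,
built from the maps `x ⊗ y ↦ x ⊗ e i ⊗ y`. -/
def ptrace112Second (T : K112 H₁ H₂ →L[ℂ] K112 H₁ H₂) : HTensor H₁ H₂ →L[ℂ] HTensor H₁ H₂ :=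
  sliceSum (fun i => opTensor (.id ℂ H₁) (tensorLeft H₂ (basis H₁ i))) T

/-- The partial trace over the second factor of `H₁ ⊗ H₂ ⊗ H₂`,
built from the maps `x ⊗ y ↦ x ⊗ e i ⊗ y`. -/
def ptrace122Second (T : K122 H₁ H₂ →L[ℂ] K122 H₁ H₂) : HTensor H₁ H₂ →L[ℂ] HTensor H₁ H₂ :=
  sliceSum (fun i => opTensor (tensorRight H₁ (basis H₂ i)) (.id ℂ H₂)) T

/-- The partial trace over the third factor of `H₁ ⊗ H₂ ⊗ H₂`,
built from the maps `x ⊗ y ↦ x ⊗ y ⊗ e i`. -/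
def ptrace122Third (T : K122 H₁ H₂ →L[ℂ] K122 H₁ H₂) : HTensor H₁ H₂ →L[ℂ] HTensor H₁ H₂ :=
  sliceSum (fun i => tensorRight (HTensor H₁ H₂) (basis H₂ i)) T

/-- `T` is a source-operator on `H₁ ⊗ H₁ ⊗ H₂` for `ρ`. -/
structure IsSource112 (ρ : HTensor H₁ H₂ →L[ℂ] HTensor H₁ H₂)
    (T : K112 H₁ H₂ →L[ℂ] K112 H₁ H₂) : Prop where
  isSelfAdjoint : IsSelfAdjoint T
  isTraceClass : IsTraceClass T
  ptrace_first : ptrace112First T = ρ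
  ptrace_second : ptrace112Second T = ρ

/-- `T` is a source-operator on `H₁ ⊗ H₂ ⊗ H₂` for `ρ`. -/
structure IsSource122 (ρ : HTensor H₁ H₂ →L[ℂ] HTensor H₁ H₂)
    (T : K122 H₁ H₂ →L[ℂ] K122 H₁ H₂) : Prop where
  isSelfAdjoint : IsSelfAdjoint T
  isTraceClass : IsTraceClass T
  ptrace_second : ptrace122Second T = ρ
  ptrace_third : ptrace122Third T = ρ

end SourceOperators

end Bipartite

end

/-! For (a), write `X = 1 ⊗ B 0 ⊗ 1`, `Y = 1 ⊗ 1 ⊗ B 1` and `a n = A n ⊗ 1 ⊗ 1` on the triple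
product. Tracing out the third factor turns `tr[ρ (A n ⊗ B 0)]` into `tr[T (a n) X]`, and tracing
out the second turns `tr[ρ (A n ⊗ B 1)]` into `tr[T (a n) Y]` (`IsInsertion.trace_sliceSum_comp`).
The whole sum is therefore `tr[T N]` with `N = u X + v Y`, `u = ∑ γ n 0 • a n`, `v = ∑ γ n 1 • a n`.
Trace duality (`norm_trace_comp_le`) leaves `‖N‖ ≤ 2` to be shown.

The operators `X`, `Y` commute, so they are measured jointly: with effects `E s = (1 + s X) / 2` and
`F t = (1 + t Y) / 2` for signs `s`, `t`, one has `N = ∑ (s u + t v) E s F t`. Commutation rewrites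
this as `∑ Q* D Q` with `D = s u + t v`, `Q = √(E s) √(F t)` and `∑ Q* Q = 1`, so `‖N‖ ≤ max ‖D‖`.
Each `‖D‖` is at most `∑ n, |s γ n 0 + t γ n 1|`, which the condition on `γ` bounds by 2
(`abs_add_abs_le_two`).

Part (b) is the same argument with the two parties exchanged. -/

noncomputable section

namespace Bipartite

/-! ### Decomposition of an operator into two-valued effects. -/

section Signs

variable {R : Type*} [Ring R] [Algebra ℝ R]

/-- The signs `1` and `-1`. -/
def sign : Fin 2 → ℝ := ![1, -1]

lemma abs_sign (i : Fin 2) : |sign i| = 1 := by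
  fin_cases i <;> simp [sign]

/-- The elements `(1 + X) / 2` and `(1 - X) / 2`. -/
def effect (X : R) (i : Fin 2) : R := (1 / 2 : ℝ) • (1 + sign i • X)

lemma sum_effect (X : R) : ∑ i, effect X i = 1 := by
  simp only [effect, sign, Fin.sum_univ_two, Matrix.cons_val_zero, Matrix.cons_val_one]
  module

lemma sum_sign_smul_effect (X : R) : ∑ i, sign i • effect X i = X := by
  simp only [effect, sign, Fin.sum_univ_two, Matrix.cons_val_zero, Matrix.cons_val_one]
  module

lemma sum_effect_mul_effect (X Y : R) :
    ∑ i : Fin 2 × Fin 2, effect X i.1 * effect Y i.2 = 1 := by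
  simp only [Fintype.sum_prod_type, ← Finset.mul_sum, sum_effect, mul_one]

/-- The sign attached to `u` recovers `X` from its effects, while the effects of `Y` sum to `1`; for
`v` the roles are exchanged. No commutativity is needed. -/
lemma sum_sign_smul_mul_effect (u v X Y : R) :
    ∑ i : Fin 2 × Fin 2, (sign i.1 • u + sign i.2 • v) * (effect X i.1 * effect Y i.2) =
      u * X + v * Y := by
  have h1 (i j : Fin 2) : (sign i • u + sign j • v) * (effect X i * effect Y j) =
      u * ((sign i • effect X i) * effect Y j) + v * (effect X i * (sign j • effect Y j)) := by
    simp only [add_mul, smul_mul_assoc, mul_smul_comm]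
  simp only [Fintype.sum_prod_type, h1, Finset.sum_add_distrib, ← Finset.mul_sum, sum_effect,
    sum_sign_smul_effect, mul_one]
  simp only [← Finset.sum_mul, sum_effect, one_mul]

end Signs

/-! ### The operator norm inequality of CHSH type. -/

section NormBound

variable {K : Type*} [NormedAddCommGroup K] [InnerProductSpace ℂ K] [CompleteSpace K]

/-- A noncommutative convex combination of operators of norm at most `c` has norm at most `c`. -/
lemma norm_sum_adjoint_comp_comp_le {ι : Type*} [Fintype ι] {Q D : ι → K →L[ℂ] K} {c : ℝ}
    (hQ : ∑ i, star (Q i) * Q i = 1) (hD : ∀ i, ‖D i‖ ≤ c) (hc : 0 ≤ c) :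
    ‖∑ i, star (Q i) * D i * Q i‖ ≤ c := by
  have hsq (u : K) : ∑ i, ‖Q i u‖ ^ 2 = ‖u‖ ^ 2 := by
    have h := congrArg (fun R : K →L[ℂ] K => (⟪u, R u⟫_ℂ).re) hQ
    simp only [sum_apply, inner_sum, Complex.re_sum,
      one_apply_eq_self, mul_apply_eq_comp,
      ContinuousLinearMap.star_eq_adjoint, ContinuousLinearMap.adjoint_inner_right] at h
    simpa only [inner_self_eq_norm_sq_to_K, ← Complex.ofReal_pow, Complex.coe_algebraMap,
      Complex.ofReal_re] using h
  have hbound (u v : K) : ‖⟪u, (∑ i, star (Q i) * D i * Q i) v⟫_ℂ‖ ≤ c * (‖u‖ * ‖v‖) := by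
    calc ‖⟪u, (∑ i, star (Q i) * D i * Q i) v⟫_ℂ‖
        = ‖∑ i, ⟪Q i u, D i (Q i v)⟫_ℂ‖ := by
          simp only [sum_apply, inner_sum, mul_apply_eq_comp,
            ContinuousLinearMap.star_eq_adjoint, ContinuousLinearMap.adjoint_inner_right]
      _ ≤ ∑ i, c * (‖Q i u‖ * ‖Q i v‖) := by
          refine (norm_sum_le _ _).trans (Finset.sum_le_sum fun i _ => ?_)
          refine (norm_inner_le_norm _ _).trans ?_
          have := (D i).le_of_opNorm_le (hD i) (Q i v)
          calc ‖Q i u‖ * ‖D i (Q i v)‖ ≤ ‖Q i u‖ * (c * ‖Q i v‖) := by gcongr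
            _ = _ := by ring
      _ ≤ c * (‖u‖ * ‖v‖) := by
          rw [← Finset.mul_sum]
          gcongr
          -- Cauchy–Schwarz over the index `i`; by `hsq` both square sums are those of the original
          -- vectors.
          have := Real.sum_mul_le_sqrt_mul_sqrt Finset.univ (fun i => ‖Q i u‖) (fun i => ‖Q i v‖)
          rwa [hsq, hsq, Real.sqrt_sq (norm_nonneg _), Real.sqrt_sq (norm_nonneg _)] at this
  refine ContinuousLinearMap.opNorm_le_bound _ hc fun v => ?_
  set w := (∑ i, star (Q i) * D i * Q i) v with hw
  -- Testing against the image `w` itself gives `‖w‖ ^ 2 ≤ c * (‖w‖ * ‖v‖)`; one factor `‖w‖` is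
  -- then cancelled.
  have h := hbound w v
  rw [← hw, inner_self_eq_norm_sq_to_K, norm_pow, RCLike.norm_ofReal, abs_norm] at h
  rcases (norm_nonneg w).eq_or_lt with h0 | h0
  · rw [← h0]; positivity
  · nlinarith

/-- From `(1 - x) * (1 - y) ≥ 0` and `(1 + x) * (1 + y) ≥ 0` follows `|x + y| ≤ 1 + x * y`. Adding
the two instances, the products cancel by `h`. -/
lemma abs_add_abs_le_two {a b c d : ℝ} (ha : |a| ≤ 1) (hb : |b| ≤ 1) (hc : |c| ≤ 1)
    (hd : |d| ≤ 1) (h : a * b = -(c * d)) : |a + b| + |c + d| ≤ 2 := by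
  have key {x y : ℝ} (hx : |x| ≤ 1) (hy : |y| ≤ 1) : |x + y| ≤ 1 + x * y := by
    rw [abs_le] at *
    constructor <;> nlinarith
  linarith [key ha hb, key hc hd]

lemma effect_nonneg {X : K →L[ℂ] K} (hX : IsSelfAdjoint X) (hX1 : ‖X‖ ≤ 1) (i : Fin 2) :
    0 ≤ effect X i := by
  refine smul_nonneg (by norm_num) ?_
  have hs : IsSelfAdjoint (sign i • X) := (IsSelfAdjoint.all (sign i)).smul hX
  have h1 := hs.neg_algebraMap_norm_le_self
  have h2 : algebraMap ℝ (K →L[ℂ] K) ‖sign i • X‖ ≤ 1 := by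
    rw [← map_one (algebraMap ℝ (K →L[ℂ] K))]
    apply algebraMap_mono
    rw [norm_smul, Real.norm_eq_abs, abs_sign, one_mul]
    exact hX1
  have h3 := (neg_le_neg h2).trans h1
  rw [← sub_nonneg] at h3
  simpa [add_comm] using h3

/-- The CHSH-type norm bound for commuting self-adjoint contractions `X`, `Y`, and contractions
`a n` that commute with both. -/
theorem norm_chsh_le_two {a : Fin 2 → K →L[ℂ] K} {X Y : K →L[ℂ] K} (ha : ∀ n, ‖a n‖ ≤ 1)
    (hX : IsSelfAdjoint X) (hY : IsSelfAdjoint Y) (hX1 : ‖X‖ ≤ 1) (hY1 : ‖Y‖ ≤ 1)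
    (hXY : Commute X Y) (haX : ∀ n, Commute (a n) X) (haY : ∀ n, Commute (a n) Y)
    {g h : Fin 2 → ℝ} (hg : ∀ n, |g n| ≤ 1) (hh : ∀ n, |h n| ≤ 1)
    (hgh : g 0 * h 0 = -(g 1 * h 1)) :
    ‖(∑ n, g n • a n) * X + (∑ n, h n • a n) * Y‖ ≤ 2 := by
  let s : (K →L[ℂ] K) → Fin 2 → K →L[ℂ] K := fun Z i => CFC.sqrt (effect Z i)
  have hss {Z : K →L[ℂ] K} (hZ : IsSelfAdjoint Z) (hZ1 : ‖Z‖ ≤ 1) (i) :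
      s Z i * s Z i = effect Z i :=
    CFC.sqrt_mul_sqrt_self _ (effect_nonneg hZ hZ1 i)
  have hsa (Z : K →L[ℂ] K) (i) : star (s Z i) = s Z i :=
    (IsSelfAdjoint.of_nonneg (CFC.sqrt_nonneg (effect Z i))).star_eq
  -- The square root is a functional calculus of `effect Z i`, hence commutes with everything that
  -- commutes with `Z`.
  have hcs {Z W : K →L[ℂ] K} (hc : Commute W Z) (i) : Commute W (s Z i) :=
    ((((Commute.one_right W).add_right (hc.smul_right _)).smul_right _).symm.cfcₙ_nnreal _).symm
  let D : Fin 2 × Fin 2 → K →L[ℂ] K := fun i =>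
    sign i.1 • (∑ n, g n • a n) + sign i.2 • ∑ n, h n • a n
  let Q : Fin 2 × Fin 2 → K →L[ℂ] K := fun i => s X i.1 * s Y i.2
  have hDeq (i) : D i = ∑ n, (g n * sign i.1 + h n * sign i.2) • a n := by
    simp only [D, Finset.smul_sum, ← Finset.sum_add_distrib, smul_smul, ← add_smul, mul_comm]
  have hD (i) : ‖D i‖ ≤ 2 := by
    calc ‖D i‖ ≤ ∑ n, |g n * sign i.1 + h n * sign i.2| := by
          rw [hDeq]
          refine (norm_sum_le _ _).trans (Finset.sum_le_sum fun n _ => ?_)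
          rw [norm_smul, Real.norm_eq_abs]
          exact mul_le_of_le_one_right (abs_nonneg _) (ha n)
      _ ≤ 2 := by
          rw [Fin.sum_univ_two]
          refine abs_add_abs_le_two ?_ ?_ ?_ ?_ ?_
          iterate 4 rw [abs_mul, abs_sign, mul_one]; first | exact hg _ | exact hh _
          linear_combination sign i.1 * sign i.2 * hgh
  -- Stated for general `E`: the case `E = 1` gives the normalization `∑ Q* Q = 1`, and `E = D i`
  -- gives the decomposition of the operator.
  have hQD (E : K →L[ℂ] K) (hEX : Commute E X) (hEY : Commute E Y) (i) :
      star (Q i) * E * Q i = E * (effect X i.1 * effect Y i.2) := by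
    have h1 : Commute (s X i.1) (s Y i.2) := hcs (hcs hXY.symm i.1).symm i.2
    have e1 := (hcs hEX i.1).eq
    have e2 := (hcs hEY i.2).eq
    simp only [Q, star_mul, hsa]
    rw [← hss hX hX1, ← hss hY hY1]
    calc s Y i.2 * s X i.1 * E * (s X i.1 * s Y i.2)
        = s Y i.2 * (s X i.1 * E) * (s X i.1 * s Y i.2) := by simp only [mul_assoc]
      _ = (s Y i.2 * E) * (s X i.1 * s X i.1) * s Y i.2 := by rw [← e1]; simp only [mul_assoc]
      _ = E * (s Y i.2 * (s X i.1 * s X i.1)) * s Y i.2 := by rw [← e2]; simp only [mul_assoc]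
      _ = _ := by
        rw [(h1.symm.mul_right h1.symm).eq]; simp only [mul_assoc]
  have hsum : ∑ i, star (Q i) * Q i = 1 := by
    have := fun i => hQD 1 (Commute.one_left X) (Commute.one_left Y) i
    simp only [mul_one, one_mul] at this
    simp only [this, sum_effect_mul_effect]
  have hDX (i) : Commute (D i) X := by
    rw [hDeq]; exact Commute.sum_left _ _ _ fun n _ => (haX n).smul_left _
  have hDY (i) : Commute (D i) Y := by
    rw [hDeq]; exact Commute.sum_left _ _ _ fun n _ => (haY n).smul_left _
  rw [← sum_sign_smul_mul_effect, ← Finset.sum_congr rfl fun i _ => hQD (D i) (hDX i) (hDY i) i]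
  exact norm_sum_adjoint_comp_comp_le hsum hD zero_le_two

end NormBound

/-! ### Hilbert–Schmidt operators, basis independence of the trace, trace duality. -/

section TraceClass

variable {H : Type*} [NormedAddCommGroup H] [InnerProductSpace ℂ H]

lemma hasSum_norm_inner_sq {ι : Type*} (b : HilbertBasis ι ℂ H) (x : H) :
    HasSum (fun i => ‖⟪b i, x⟫_ℂ‖ ^ 2) (‖x‖ ^ 2) := by
  have h := Complex.hasSum_re (b.hasSum_inner_mul_inner x x)
  simp only [inner_self_eq_norm_sq_to_K, ← Complex.ofReal_pow, Complex.coe_algebraMap,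
      Complex.ofReal_re] at h
  convert h using 2 with i
  rw [← inner_conj_symm x (b i), ← Complex.normSq_eq_conj_mul_self, Complex.ofReal_re,
    Complex.normSq_eq_norm_sq]

lemma summable_norm_inner_sq {ι κ : Type*} (b : HilbertBasis ι ℂ H) (c : κ → H)
    (A : H →L[ℂ] H) (hA : Summable fun l => ‖A (c l)‖ ^ 2) :
    Summable fun p : ι × κ => ‖⟪b p.1, A (c p.2)⟫_ℂ‖ ^ 2 := by
  rw [← (Equiv.prodComm κ ι).summable_iff]
  refine (summable_prod_of_nonneg fun _ => sq_nonneg _).2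
    ⟨fun l => (hasSum_norm_inner_sq b (A (c l))).summable, ?_⟩
  exact hA.congr fun l => (hasSum_norm_inner_sq b (A (c l))).tsum_eq.symm

variable [CompleteSpace H]

lemma inner_apply_left_of_isSelfAdjoint {S : H →L[ℂ] H} (hS : IsSelfAdjoint S) (x y : H) :
    ⟪S x, y⟫_ℂ = ⟪x, S y⟫_ℂ :=
  hS.isSymmetric x y

/-- Parseval in both orders: each side is a marginal of the double sum of squared matrix entries. -/
lemma summable_norm_sq_of_adjoint {ι κ : Type*} (b : HilbertBasis ι ℂ H) (c : HilbertBasis κ ℂ H)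
    (A : H →L[ℂ] H) (hA : Summable fun l => ‖A.adjoint (c l)‖ ^ 2) :
    Summable fun i => ‖A (b i)‖ ^ 2 := by
  have h := summable_norm_inner_sq b c A.adjoint hA
  refine ((summable_prod_of_nonneg fun _ => sq_nonneg _).1 h).2.congr fun i => ?_
  rw [← (hasSum_norm_inner_sq c (A (b i))).tsum_eq]
  refine tsum_congr fun l => ?_
  rw [ContinuousLinearMap.adjoint_inner_right, ← inner_conj_symm, RCLike.norm_conj]

/-- The trace of `S * S * N`, for a Hilbert-Schmidt operator `S`, in any orthonormal basis. -/
lemma hasSum_inner_sq_comp {ι κ : Type*} (b : HilbertBasis ι ℂ H) (c : HilbertBasis κ ℂ H)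
    {S : H →L[ℂ] H} (hS : IsSelfAdjoint S) (hc : Summable fun l => ‖S (c l)‖ ^ 2)
    (N : H →L[ℂ] H) :
    HasSum (fun k => ⟪b k, S (S (N (b k)))⟫_ℂ) (∑' l, ⟪S (c l), N (S (c l))⟫_ℂ) := by
  have hS' : S.adjoint = S := hS.adjoint_eq
  have hb : Summable fun k => ‖S (b k)‖ ^ 2 :=
    summable_norm_sq_of_adjoint b c S (by rwa [hS'])
  have hSN : Summable fun k => ‖(S ∘L N) (b k)‖ ^ 2 := by
    refine summable_norm_sq_of_adjoint b c _ ?_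
    rw [ContinuousLinearMap.adjoint_comp, hS']
    refine (hc.mul_left (‖N.adjoint‖ ^ 2)).of_nonneg_of_le (fun _ => sq_nonneg _) fun l => ?_
    rw [← mul_pow]
    gcongr
    exact N.adjoint.le_opNorm _
  have h1 := summable_norm_inner_sq c b S hb
  have h2 := summable_norm_inner_sq c b _ hSN
  -- Summed over `k`, `F` gives `⟪S (c l), N (S (c l))⟫`; summed over `l`, it gives `⟪b k, S (S (N
  -- (b k)))⟫`. Absolute summability, from the two Hilbert–Schmidt bounds, allows the exchange.
  let F : κ × ι → ℂ := fun p => ⟪S (b p.2), c p.1⟫_ℂ * ⟪c p.1, S (N (b p.2))⟫_ℂ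
  have hF : Summable F := by
    refine (h1.add h2).of_norm_bounded fun p => ?_
    rw [norm_mul, ← inner_conj_symm, RCLike.norm_conj]
    change _ ≤ _ + ‖⟪c p.1, S (N (b p.2))⟫_ℂ‖ ^ 2
    nlinarith [sq_nonneg (‖⟪c p.1, S (b p.2)⟫_ℂ‖ - ‖⟪c p.1, S (N (b p.2))⟫_ℂ‖),
      sq_nonneg ‖⟪c p.1, S (b p.2)⟫_ℂ‖, sq_nonneg ‖⟪c p.1, S (N (b p.2))⟫_ℂ‖]
  have hl : HasSum (fun l => ⟪S (c l), N (S (c l))⟫_ℂ) (∑' p, F p) := by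
    refine hF.hasSum.prod_fiberwise fun l => ?_
    have hFl : (fun k => F (l, k)) =
        fun k => ⟪N.adjoint (S (c l)), b k⟫_ℂ * ⟪b k, S (c l)⟫_ℂ := by
      funext k
      rw [ContinuousLinearMap.adjoint_inner_left, mul_comm, inner_apply_left_of_isSelfAdjoint hS,
        ← inner_apply_left_of_isSelfAdjoint hS (b k)]
    rw [hFl, ← ContinuousLinearMap.adjoint_inner_left]
    exact b.hasSum_inner_mul_inner _ _
  have hk : HasSum (fun k => ⟪b k, S (S (N (b k)))⟫_ℂ) (∑' p, F p) := by
    refine ((Equiv.prodComm ι κ).hasSum_iff.2 hF.hasSum).prod_fiberwise fun k => ?_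
    have hFk : (fun l => (F ∘ Equiv.prodComm ι κ) (k, l)) =
        fun l => ⟪S (b k), c l⟫_ℂ * ⟪c l, S (N (b k))⟫_ℂ := rfl
    rw [hFk, ← inner_apply_left_of_isSelfAdjoint hS (b k)]
    exact c.hasSum_inner_mul_inner (S (b k)) (S (N (b k)))
  rwa [hl.tsum_eq]

lemma norm_sqrt_apply_sq {P : H →L[ℂ] H} (hP : 0 ≤ P) (x : H) :
    ‖CFC.sqrt P x‖ ^ 2 = (⟪x, P x⟫_ℂ).re := by
  have hs : IsSelfAdjoint (CFC.sqrt P) := .of_nonneg (CFC.sqrt_nonneg P)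
  nth_rw 2 [← CFC.sqrt_mul_sqrt_self P hP]
  rw [mul_apply_eq_comp, ← inner_apply_left_of_isSelfAdjoint hs, inner_self_eq_norm_sq_to_K]
  simp [← Complex.ofReal_pow]

/-- The square root of the positive part of `T`. -/
def sqrtPos (T : H →L[ℂ] H) : H →L[ℂ] H := CFC.sqrt (T⁺)

/-- The square root of the negative part of `T`. -/
def sqrtNeg (T : H →L[ℂ] H) : H →L[ℂ] H := CFC.sqrt (T⁻)

lemma isSelfAdjoint_sqrtPos (T : H →L[ℂ] H) : IsSelfAdjoint (sqrtPos T) :=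
  .of_nonneg (CFC.sqrt_nonneg _)

lemma isSelfAdjoint_sqrtNeg (T : H →L[ℂ] H) : IsSelfAdjoint (sqrtNeg T) :=
  .of_nonneg (CFC.sqrt_nonneg _)

lemma sqrtPos_sub_sqrtNeg_apply {T : H →L[ℂ] H} (hT : IsSelfAdjoint T) (x : H) :
    sqrtPos T (sqrtPos T x) - sqrtNeg T (sqrtNeg T x) = T x := by
  rw [← mul_apply_eq_comp, ← mul_apply_eq_comp, sqrtPos, sqrtNeg,
    CFC.sqrt_mul_sqrt_self _ (CFC.posPart_nonneg T),
    CFC.sqrt_mul_sqrt_self _ (CFC.negPart_nonneg T), ← sub_apply, CFC.posPart_sub_negPart T hT]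

/-- Since `|T| = T⁺ + T⁻`, the trace norm splits into the squared Hilbert–Schmidt norms of the two
square roots. -/
lemma norm_sqrtPos_sq_add_norm_sqrtNeg_sq {T : H →L[ℂ] H} (hT : IsSelfAdjoint T) (x : H) :
    ‖sqrtPos T x‖ ^ 2 + ‖sqrtNeg T x‖ ^ 2 = (⟪x, CFC.abs T x⟫_ℂ).re := by
  rw [sqrtPos, sqrtNeg, norm_sqrt_apply_sq (CFC.posPart_nonneg T),
    norm_sqrt_apply_sq (CFC.negPart_nonneg T), ← CFC.posPart_add_negPart T hT, add_apply,
    inner_add_right, Complex.add_re]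

lemma summable_norm_sqrtPos_sq {T : H →L[ℂ] H} (hT : IsSelfAdjoint T) (hT1 : IsTraceClass T) :
    Summable fun i => ‖sqrtPos T (basis H i)‖ ^ 2 := by
  refine Summable.of_nonneg_of_le (fun _ => sq_nonneg _) (fun i => ?_) hT1
  rw [← norm_sqrtPos_sq_add_norm_sqrtNeg_sq hT]
  exact le_add_of_nonneg_right (sq_nonneg _)

lemma summable_norm_sqrtNeg_sq {T : H →L[ℂ] H} (hT : IsSelfAdjoint T) (hT1 : IsTraceClass T) :
    Summable fun i => ‖sqrtNeg T (basis H i)‖ ^ 2 := by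
  refine Summable.of_nonneg_of_le (fun _ => sq_nonneg _) (fun i => ?_) hT1
  rw [← norm_sqrtPos_sq_add_norm_sqrtNeg_sq hT]
  exact le_add_of_nonneg_left (sq_nonneg _)

/-- The value on the right does not involve `b`; this is the source of basis independence. -/
lemma hasSum_inner_comp {ι : Type*} (b : HilbertBasis ι ℂ H) {T : H →L[ℂ] H}
    (hT : IsSelfAdjoint T) (hT1 : IsTraceClass T) (N : H →L[ℂ] H) :
    HasSum (fun k => ⟪b k, T (N (b k))⟫_ℂ)
      (∑' l, ⟪sqrtPos T (basis H l), N (sqrtPos T (basis H l))⟫_ℂ -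
        ∑' l, ⟪sqrtNeg T (basis H l), N (sqrtNeg T (basis H l))⟫_ℂ) := by
  have h := (hasSum_inner_sq_comp b (basis H) (isSelfAdjoint_sqrtPos T)
    (summable_norm_sqrtPos_sq hT hT1) N).sub
    (hasSum_inner_sq_comp b (basis H) (isSelfAdjoint_sqrtNeg T)
    (summable_norm_sqrtNeg_sq hT hT1) N)
  simpa only [← inner_sub_right, sqrtPos_sub_sqrtNeg_apply hT] using h

/-- The trace of `T * N` can be computed in any orthonormal basis. -/
lemma hasSum_trace_comp {ι : Type*} (b : HilbertBasis ι ℂ H) {T : H →L[ℂ] H}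
    (hT : IsSelfAdjoint T) (hT1 : IsTraceClass T) (N : H →L[ℂ] H) :
    HasSum (fun k => ⟪b k, T (N (b k))⟫_ℂ) (trace (T ∘L N)) := by
  have h := hasSum_inner_comp b hT hT1 N
  rwa [← (hasSum_inner_comp (basis H) hT hT1 N).tsum_eq] at h

lemma trace_comp_add {T : H →L[ℂ] H} (hT : IsSelfAdjoint T) (hT1 : IsTraceClass T)
    (M N : H →L[ℂ] H) : trace (T ∘L (M + N)) = trace (T ∘L M) + trace (T ∘L N) := by
  refine (hasSum_trace_comp (basis H) hT hT1 _).unique ?_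
  simpa only [add_apply, map_add, inner_add_right] using
    (hasSum_trace_comp (basis H) hT hT1 M).add (hasSum_trace_comp (basis H) hT hT1 N)

lemma trace_comp_smul (T : H →L[ℂ] H) (c : ℂ) (N : H →L[ℂ] H) :
    trace (T ∘L (c • N)) = c * trace (T ∘L N) := by
  simp only [trace, ContinuousLinearMap.comp_apply, smul_apply, map_smul, inner_smul_right,
    tsum_mul_left]

/-- The trace duality bound `|tr (T * N)| ≤ ‖N‖ * ‖T‖₁`. -/
theorem norm_trace_comp_le {T : H →L[ℂ] H} (hT : IsSelfAdjoint T) (hT1 : IsTraceClass T)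
    (N : H →L[ℂ] H) : ‖trace (T ∘L N)‖ ≤ ‖N‖ * traceNorm T := by
  have hbound {S : H →L[ℂ] H} (hS : Summable fun i => ‖S (basis H i)‖ ^ 2) :
      ‖∑' l, ⟪S (basis H l), N (S (basis H l))⟫_ℂ‖ ≤ ‖N‖ * ∑' l, ‖S (basis H l)‖ ^ 2 := by
    refine tsum_of_norm_bounded (hS.hasSum.mul_left ‖N‖) fun l => ?_
    refine (norm_inner_le_norm _ _).trans ?_
    calc ‖S (basis H l)‖ * ‖N (S (basis H l))‖
        ≤ ‖S (basis H l)‖ * (‖N‖ * ‖S (basis H l)‖) := by gcongr; exact N.le_opNorm _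
      _ = _ := by ring
  have hp := summable_norm_sqrtPos_sq hT hT1
  have hn := summable_norm_sqrtNeg_sq hT hT1
  rw [(hasSum_trace_comp (basis H) hT hT1 N).unique (hasSum_inner_comp (basis H) hT hT1 N)]
  refine (norm_sub_le _ _).trans ((add_le_add (hbound hp) (hbound hn)).trans_eq ?_)
  rw [← mul_add, ← hp.tsum_add hn, traceNorm]
  simp only [norm_sqrtPos_sq_add_norm_sqrtNeg_sq hT]

end TraceClass

/-! ### Partial traces through orthogonal families of isometries. -/

section Insertion

variable {H K : Type*} [NormedAddCommGroup H] [InnerProductSpace ℂ H]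
  [NormedAddCommGroup K] [InnerProductSpace ℂ K]

/-- A family of isometries with mutually orthogonal ranges that together span a dense subspace. -/
structure IsInsertion {ι : Type*} (V : ι → H →L[ℂ] K) : Prop where
  inner_self : ∀ i x y, ⟪V i x, V i y⟫_ℂ = ⟪x, y⟫_ℂ
  inner_of_ne : ∀ i j, i ≠ j → ∀ x y, ⟪V i x, V j y⟫_ℂ = 0
  total : ∀ z, (∀ i x, ⟪V i x, z⟫_ℂ = 0) → z = 0

variable {ι κ : Type*} {V : ι → H →L[ℂ] K}

lemma IsInsertion.orthonormal (hV : IsInsertion V) (b : HilbertBasis κ ℂ H) :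
    Orthonormal ℂ fun p : κ × ι => V p.2 (b p.1) := by
  classical
  rw [orthonormal_iff_ite]
  rintro ⟨k, i⟩ ⟨l, j⟩
  by_cases hij : i = j
  · subst hij
    simp [hV.inner_self, orthonormal_iff_ite.1 b.orthonormal]
  · simp [hV.inner_of_ne i j hij, hij]

variable [CompleteSpace K]

/-- The orthonormal basis of `K` built from an orthonormal basis of `H` and an insertion family. -/
def IsInsertion.hilbertBasis (hV : IsInsertion V) (b : HilbertBasis κ ℂ H) :
    HilbertBasis (κ × ι) ℂ K :=
  HilbertBasis.mkOfOrthogonalEqBot (hV.orthonormal b) <| by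
    rw [Submodule.eq_bot_iff]
    intro z hz
    refine hV.total z fun i => ?_
    -- Orthogonality to `V i (b k)` for all `k` extends to `V i x` for all `x` by linearity and
    -- density.
    have hcl : IsClosed {x : H | ⟪V i x, z⟫_ℂ = 0} :=
      isClosed_eq ((V i).continuous.inner continuous_const) continuous_const
    have hspan : (Submodule.span ℂ (Set.range b) : Set H) ⊆ {x : H | ⟪V i x, z⟫_ℂ = 0} := by
      intro x hx
      induction hx using Submodule.span_induction with
      | mem x hx =>
        obtain ⟨k, rfl⟩ := hx
        exact (Submodule.mem_orthogonal _ _).1 hz _ (Submodule.subset_span ⟨(k, i), rfl⟩)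
      | zero => simp
      | add x y _ _ hx hy =>
        rw [Set.mem_ofPred_eq] at *
        rw [map_add, inner_add_left, hx, hy, add_zero]
      | smul c x _ hx =>
        rw [Set.mem_ofPred_eq] at *
        rw [map_smul, inner_smul_left, hx, mul_zero]
    intro x
    have hx : x ∈ (Submodule.span ℂ (Set.range b)).topologicalClosure := by
      rw [b.dense_span]; trivial
    exact hcl.closure_subset_iff.2 hspan hx

lemma IsInsertion.hilbertBasis_apply (hV : IsInsertion V) (b : HilbertBasis κ ℂ H) (p : κ × ι) :
    hV.hilbertBasis b p = V p.2 (b p.1) := by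
  simp [hilbertBasis]

variable [CompleteSpace H]

/-- The defining property of the partial trace. A nonzero value of `sliceSum` guarantees that the
series converges. -/
theorem IsInsertion.trace_sliceSum_comp (hV : IsInsertion V) {T : K →L[ℂ] K}
    (hT : IsSelfAdjoint T) (hT1 : IsTraceClass T) (h0 : sliceSum V T ≠ 0)
    {M : H →L[ℂ] H} {N : K →L[ℂ] K} (hMN : ∀ i, V i ∘L M = N ∘L V i) :
    trace (sliceSum V T ∘L M) = trace (T ∘L N) := by
  have hs : Summable fun i => (V i).adjoint ∘L T ∘L V i := by
    by_contra h
    exact h0 (tsum_eq_zero_of_not_summable h)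
  have h := hasSum_trace_comp (hV.hilbertBasis (basis H)) hT hT1 N
  simp only [hV.hilbertBasis_apply] at h
  -- The trace on `K` is a sum over pairs `(j, i)`; summing over `i` first produces the diagonal
  -- entries of `sliceSum V T ∘L M`.
  refine (h.prod_fiberwise fun j => ?_).tsum_eq
  have h1 := (innerSL ℂ (basis H j)).hasSum
    ((ContinuousLinearMap.apply ℂ H (M (basis H j))).hasSum hs.hasSum)
  have h2 (i : ι) : ⟪basis H j, ((V i).adjoint ∘L T ∘L V i) (M (basis H j))⟫_ℂ =
      ⟪V i (basis H j), T (N (V i (basis H j)))⟫_ℂ := by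
    rw [ContinuousLinearMap.comp_apply, ContinuousLinearMap.adjoint_inner_right,
      ContinuousLinearMap.comp_apply, ← ContinuousLinearMap.comp_apply (V i), hMN,
      ContinuousLinearMap.comp_apply]
  simp only [← h2]
  exact h1

end Insertion

/-! ### Operators and insertions on Hilbert tensor products. -/

section Tensor

variable {H K : Type*} [NormedAddCommGroup H] [InnerProductSpace ℂ H]
  [NormedAddCommGroup K] [InnerProductSpace ℂ K]
  {H' K' : Type*} [NormedAddCommGroup H'] [InnerProductSpace ℂ H']
  [NormedAddCommGroup K'] [InnerProductSpace ℂ K']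
  {H'' K'' : Type*} [NormedAddCommGroup H''] [InnerProductSpace ℂ H'']
  [NormedAddCommGroup K''] [InnerProductSpace ℂ K'']

lemma tensorLeft_apply (x : H) (y : K) :
    tensorLeft K x y = ((x ⊗ₜ[ℂ] y : H ⊗[ℂ] K) : HTensor H K) :=
  rfl

lemma tensorRight_apply (x : H) (y : K) :
    tensorRight H y x = ((x ⊗ₜ[ℂ] y : H ⊗[ℂ] K) : HTensor H K) :=
  rfl

lemma opTensor_coe_tmul (A : H →L[ℂ] H') (B : K →L[ℂ] K') (x : H) (y : K) :
    opTensor A B ((x ⊗ₜ[ℂ] y : H ⊗[ℂ] K) : HTensor H K) =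
      ((A x ⊗ₜ[ℂ] B y : H' ⊗[ℂ] K') : HTensor H' K') :=
  ContinuousLinearMap.completion_apply_coe _ _

lemma inner_coe_tmul (x x' : H) (y y' : K) :
    ⟪((x ⊗ₜ[ℂ] y : H ⊗[ℂ] K) : HTensor H K), ((x' ⊗ₜ[ℂ] y' : H ⊗[ℂ] K) : HTensor H K)⟫_ℂ =
      ⟪x, x'⟫_ℂ * ⟪y, y'⟫_ℂ := by
  rw [UniformSpace.Completion.inner_coe, TensorProduct.inner_tmul]

@[elab_as_elim]
lemma HTensor.induction {p : HTensor H K → Prop} (z : HTensor H K) (hp : IsClosed {z | p z})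
    (tmul : ∀ x y, p ((x ⊗ₜ[ℂ] y : H ⊗[ℂ] K) : HTensor H K))
    (add : ∀ z w, p z → p w → p (z + w)) : p z := by
  refine UniformSpace.Completion.induction_on z hp fun t => ?_
  induction t with
  | zero => simpa using tmul 0 0
  | tmul x y => exact tmul x y
  | add s t hs ht => rw [UniformSpace.Completion.coe_add]; exact add _ _ hs ht

lemma HTensor.clm_ext {E : Type*} [NormedAddCommGroup E] [NormedSpace ℂ E]
    {f g : HTensor H K →L[ℂ] E}
    (h : ∀ x y, f ((x ⊗ₜ[ℂ] y : H ⊗[ℂ] K) : HTensor H K) =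
      g ((x ⊗ₜ[ℂ] y : H ⊗[ℂ] K) : HTensor H K)) : f = g := by
  ext z
  induction z using HTensor.induction with
  | hp => exact isClosed_eq f.continuous g.continuous
  | tmul x y => exact h x y
  | add z w hz hw => rw [map_add, map_add, hz, hw]

lemma opTensor_comp (A' : H' →L[ℂ] H'') (A : H →L[ℂ] H') (B' : K' →L[ℂ] K'') (B : K →L[ℂ] K') :
    opTensor A' B' ∘L opTensor A B = opTensor (A' ∘L A) (B' ∘L B) :=
  HTensor.clm_ext fun x y => by
    simp only [ContinuousLinearMap.comp_apply, opTensor_coe_tmul]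

lemma norm_opTensor_le (A : H →L[ℂ] H') (B : K →L[ℂ] K') : ‖opTensor A B‖ ≤ ‖A‖ * ‖B‖ := by
  refine ContinuousLinearMap.opNorm_le_bound _ (by positivity) fun z => ?_
  induction z using UniformSpace.Completion.induction_on with
  | hp => exact isClosed_le (by fun_prop) (by fun_prop)
  | ih t =>
    rw [opTensor, ContinuousLinearMap.completion_apply_coe, UniformSpace.Completion.norm_coe,
      UniformSpace.Completion.norm_coe]
    exact ContinuousLinearMap.le_of_opNorm_le _ (TensorProduct.norm_mapL_le A B) t

lemma norm_opTensor_le_one {A : H →L[ℂ] H'} {B : K →L[ℂ] K'} (hA : ‖A‖ ≤ 1) (hB : ‖B‖ ≤ 1) :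
    ‖opTensor A B‖ ≤ 1 :=
  (norm_opTensor_le A B).trans (mul_le_one₀ hA (norm_nonneg _) hB)

lemma inner_opTensor_of_inner {A : H →L[ℂ] H'} {A' : H' →L[ℂ] H} {B : K →L[ℂ] K'}
    {B' : K' →L[ℂ] K} (hA : ∀ x y, ⟪A x, y⟫_ℂ = ⟪x, A' y⟫_ℂ) (hB : ∀ x y, ⟪B x, y⟫_ℂ = ⟪x, B' y⟫_ℂ)
    (z : HTensor H K) (w : HTensor H' K') :
    ⟪opTensor A B z, w⟫_ℂ = ⟪z, opTensor A' B' w⟫_ℂ := by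
  induction z using HTensor.induction with
  | hp => exact isClosed_eq (by fun_prop) (by fun_prop)
  | add z z' h h' => rw [map_add, inner_add_left, inner_add_left, h, h']
  | tmul x y =>
    induction w using HTensor.induction with
    | hp => exact isClosed_eq (by fun_prop) (by fun_prop)
    | add w w' h h' => rw [map_add, inner_add_right, inner_add_right, h, h']
    | tmul x' y' => simp only [opTensor_coe_tmul, inner_coe_tmul, hA, hB]

lemma isSelfAdjoint_opTensor [CompleteSpace H] [CompleteSpace K] {A : H →L[ℂ] H} {B : K →L[ℂ] K}
    (hA : IsSelfAdjoint A) (hB : IsSelfAdjoint B) : IsSelfAdjoint (opTensor A B) :=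
  ContinuousLinearMap.isSelfAdjoint_iff_isSymmetric.2
    (inner_opTensor_of_inner hA.isSymmetric hB.isSymmetric)

lemma HTensor.eq_zero_of_inner_tmul (z : HTensor H K)
    (h : ∀ x y, ⟪((x ⊗ₜ[ℂ] y : H ⊗[ℂ] K) : HTensor H K), z⟫_ℂ = 0) : z = 0 := by
  refine ext_inner_left ℂ fun w => ?_
  rw [inner_zero_right]
  induction w using HTensor.induction with
  | hp => exact isClosed_eq (by fun_prop) (by fun_prop)
  | add w w' h h' => rw [inner_add_left, h, h', add_zero]
  | tmul x y => exact h x y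

/-- A continuous linear map that vanishes on an orthonormal basis is zero. -/
lemma clm_eq_zero_of_basis {ι E : Type*} [NormedAddCommGroup E] [NormedSpace ℂ E]
    (b : HilbertBasis ι ℂ H) (f : H →L[ℂ] E) (hf : ∀ i, f (b i) = 0) : f = 0 := by
  refine ContinuousLinearMap.ext_on (s := Set.range b) ?_ ?_
  · exact (Submodule.dense_iff_topologicalClosure_eq_top).2 b.dense_span
  · rintro _ ⟨i, rfl⟩
    simpa using hf i

lemma isInsertion_tensorLeft {ι : Type*} (b : HilbertBasis ι ℂ H) :
    IsInsertion fun i => tensorLeft K (b i) where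
  inner_self i x y := by
    simp [tensorLeft_apply, b.orthonormal.1 i]
  inner_of_ne i j hij x y := by
    simp [tensorLeft_apply, b.orthonormal.2 hij]
  total z hz := by
    refine HTensor.eq_zero_of_inner_tmul z fun x y => ?_
    -- The inner product is linear in its second slot only, so `z` is moved to the first.
    have h0 : (innerSL ℂ z) ∘L tensorRight H y = 0 :=
      clm_eq_zero_of_basis b _ fun i => inner_eq_zero_symm.1 (hz i y)
    exact inner_eq_zero_symm.1 congr($h0 x)

lemma isInsertion_tensorRight {ι : Type*} (b : HilbertBasis ι ℂ K) :
    IsInsertion fun i => tensorRight H (b i) where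
  inner_self i x y := by
    simp [tensorRight_apply, b.orthonormal.1 i]
  inner_of_ne i j hij x y := by
    simp [tensorRight_apply, b.orthonormal.2 hij]
  total z hz := by
    refine HTensor.eq_zero_of_inner_tmul z fun x y => ?_
    have h0 : (innerSL ℂ z) ∘L tensorLeft K x = 0 :=
      clm_eq_zero_of_basis b _ fun i => inner_eq_zero_symm.1 (hz i x)
    exact inner_eq_zero_symm.1 congr($h0 y)

/-- The scalars serve both axioms of an insertion: `α = β = 1` gives isometry, and one of them `0`
gives orthogonality of ranges. -/
lemma inner_opTensor_opTensor {A A' : H →L[ℂ] H'} {B B' : K →L[ℂ] K'} {α β : ℂ}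
    (hA : ∀ x x', ⟪A x, A' x'⟫_ℂ = α * ⟪x, x'⟫_ℂ) (hB : ∀ y y', ⟪B y, B' y'⟫_ℂ = β * ⟪y, y'⟫_ℂ)
    (z w : HTensor H K) : ⟪opTensor A B z, opTensor A' B' w⟫_ℂ = α * β * ⟪z, w⟫_ℂ := by
  induction z using HTensor.induction with
  | hp => exact isClosed_eq (by fun_prop) (by fun_prop)
  | add z z' h h' => rw [map_add, inner_add_left, inner_add_left, h, h', mul_add]
  | tmul x y =>
    induction w using HTensor.induction with
    | hp => exact isClosed_eq (by fun_prop) (by fun_prop)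
    | add w w' h h' => rw [map_add, inner_add_right, inner_add_right, h, h', mul_add]
    | tmul x' y' =>
      simp only [opTensor_coe_tmul, inner_coe_tmul, hA, hB]
      ring

lemma IsInsertion.opTensor_id_left [CompleteSpace K] [CompleteSpace K'] {ι : Type*}
    {V : ι → K →L[ℂ] K'} (hV : IsInsertion V) :
    IsInsertion fun i => opTensor (.id ℂ H) (V i) where
  inner_self i x y := by
    simpa using inner_opTensor_opTensor (α := 1) (β := 1) (A := .id ℂ H) (A' := .id ℂ H)
      (by simp) (fun y y' => by rw [hV.inner_self, one_mul]) x y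
  inner_of_ne i j hij x y := by
    simpa using inner_opTensor_opTensor (α := 1) (β := 0) (A := .id ℂ H) (A' := .id ℂ H)
      (by simp) (fun y y' => by rw [hV.inner_of_ne i j hij, zero_mul]) x y
  total z hz := by
    refine HTensor.eq_zero_of_inner_tmul z fun x y => ?_
    -- The adjoint of `tensorLeft K' x` pulls `z` back to `K'`, where totality of `V` applies.
    have h0 : (tensorLeft K' x).adjoint z = 0 := hV.total _ fun i t => by
      rw [ContinuousLinearMap.adjoint_inner_right]
      simpa only [opTensor_coe_tmul, ContinuousLinearMap.id_apply, tensorLeft_apply] using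
        hz i ((x ⊗ₜ[ℂ] t : H ⊗[ℂ] K) : HTensor H K)
    rw [← tensorLeft_apply, ← ContinuousLinearMap.adjoint_inner_right, h0, inner_zero_right]

lemma IsInsertion.opTensor_id_right [CompleteSpace H] [CompleteSpace H'] {ι : Type*}
    {V : ι → H →L[ℂ] H'} (hV : IsInsertion V) :
    IsInsertion fun i => opTensor (V i) (.id ℂ K) where
  inner_self i x y := by
    simpa using inner_opTensor_opTensor (α := 1) (β := 1) (B := .id ℂ K) (B' := .id ℂ K)
      (fun y y' => by rw [hV.inner_self, one_mul]) (by simp) x y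
  inner_of_ne i j hij x y := by
    simpa using inner_opTensor_opTensor (α := 0) (β := 1) (B := .id ℂ K) (B' := .id ℂ K)
      (fun y y' => by rw [hV.inner_of_ne i j hij, zero_mul]) (by simp) x y
  total z hz := by
    refine HTensor.eq_zero_of_inner_tmul z fun x y => ?_
    have h0 : (tensorRight H' y).adjoint z = 0 := hV.total _ fun i t => by
      rw [ContinuousLinearMap.adjoint_inner_right]
      simpa only [opTensor_coe_tmul, ContinuousLinearMap.id_apply, tensorRight_apply] using
        hz i ((t ⊗ₜ[ℂ] y : H ⊗[ℂ] K) : HTensor H K)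
    rw [← tensorRight_apply, ← ContinuousLinearMap.adjoint_inner_right, h0, inner_zero_right]

lemma tensorLeft_comp (x : H) (B : K →L[ℂ] K') :
    tensorLeft K' x ∘L B = opTensor (.id ℂ H) B ∘L tensorLeft K x := by
  ext y
  simp [tensorLeft_apply, opTensor_coe_tmul]

lemma tensorRight_comp (y : K) (A : H →L[ℂ] H') :
    tensorRight H' y ∘L A = opTensor A (.id ℂ K) ∘L tensorRight H y := by
  ext x
  simp [tensorRight_apply, opTensor_coe_tmul]

end Tensor

/-- The common core of the two bounds: `V` and `W` insert the traced-out factor at its two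
possible places. -/
theorem norm_sum_trace_le_of_isInsertion {H K : Type*}
    [NormedAddCommGroup H] [InnerProductSpace ℂ H] [CompleteSpace H]
    [NormedAddCommGroup K] [InnerProductSpace ℂ K] [CompleteSpace K]
    {ι : Type*} {V W : ι → H →L[ℂ] K} (hV : IsInsertion V) (hW : IsInsertion W)
    {ρ : H →L[ℂ] H} (hρ : ρ ≠ 0) {T : K →L[ℂ] K} (hT : IsSelfAdjoint T) (hT1 : IsTraceClass T)
    (hVT : sliceSum V T = ρ) (hWT : sliceSum W T = ρ)
    {a : Fin 2 → K →L[ℂ] K} {X Y : K →L[ℂ] K} (ha : ∀ n, ‖a n‖ ≤ 1)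
    (hX : IsSelfAdjoint X) (hY : IsSelfAdjoint Y) (hX1 : ‖X‖ ≤ 1) (hY1 : ‖Y‖ ≤ 1)
    (hXY : Commute X Y) (haX : ∀ n, Commute (a n) X) (haY : ∀ n, Commute (a n) Y)
    {g h : Fin 2 → ℝ} (hg : ∀ n, |g n| ≤ 1) (hh : ∀ n, |h n| ≤ 1)
    (hgh : g 0 * h 0 = -(g 1 * h 1)) {M M' : Fin 2 → H →L[ℂ] H}
    (hM : ∀ n i, V i ∘L M n = (a n ∘L X) ∘L V i)
    (hM' : ∀ n i, W i ∘L M' n = (a n ∘L Y) ∘L W i) :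
    ‖∑ n, ((g n : ℂ) * trace (ρ ∘L M n) + (h n : ℂ) * trace (ρ ∘L M' n))‖ ≤ 2 * traceNorm T := by
  have h1 (n) : trace (ρ ∘L M n) = trace (T ∘L (a n ∘L X)) := by
    rw [← hVT, hV.trace_sliceSum_comp hT hT1 (by rwa [hVT]) (hM n)]
  have h2 (n) : trace (ρ ∘L M' n) = trace (T ∘L (a n ∘L Y)) := by
    rw [← hWT, hW.trace_sliceSum_comp hT hT1 (by rwa [hWT]) (hM' n)]
  have h3 : ∑ n, ((g n : ℂ) * trace (ρ ∘L M n) + (h n : ℂ) * trace (ρ ∘L M' n)) =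
      trace (T ∘L ((∑ n, g n • a n) * X + (∑ n, h n • a n) * Y)) := by
    simp only [Fin.sum_univ_two, add_mul, smul_mul_assoc, ← Complex.coe_smul,
      trace_comp_add hT hT1, trace_comp_smul, h1, h2, ContinuousLinearMap.mul_def]
    ring
  rw [h3]
  refine (norm_trace_comp_le hT hT1 _).trans ?_
  gcongr
  · exact tsum_nonneg fun i => by
      rw [← norm_sqrtPos_sq_add_norm_sqrtNeg_sq hT]
      positivity
  · exact norm_chsh_le_two ha hX hY hX1 hY1 hXY haX haY hg hh hgh

/-- Trace one excludes the default value `0` that a divergent `sliceSum` would take. -/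
lemma IsState.ne_zero {H : Type*} [NormedAddCommGroup H] [InnerProductSpace ℂ H]
    [CompleteSpace H] {ρ : H →L[ℂ] H} (hρ : IsState ρ) : ρ ≠ 0 := by
  rintro rfl
  simpa [trace] using hρ.trace_eq_one

lemma isSelfAdjoint_id {H : Type*} [NormedAddCommGroup H] [InnerProductSpace ℂ H]
    [CompleteSpace H] : IsSelfAdjoint (ContinuousLinearMap.id ℂ H) :=
  IsSelfAdjoint.one _

lemma norm_id_le_one {H : Type*} [NormedAddCommGroup H] [InnerProductSpace ℂ H] :
    ‖ContinuousLinearMap.id ℂ H‖ ≤ 1 :=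
  ContinuousLinearMap.norm_id_le

/-! ### The two kinds of source-operator. -/

section SourceOperators

variable {H₁ H₂ : Type*} [NormedAddCommGroup H₁] [InnerProductSpace ℂ H₁] [CompleteSpace H₁]
  [NormedAddCommGroup H₂] [InnerProductSpace ℂ H₂] [CompleteSpace H₂]

theorem norm_sum_trace_le_of_source122 {ρ : HTensor H₁ H₂ →L[ℂ] HTensor H₁ H₂} (hρ : IsState ρ)
    {A : Fin 2 → H₁ →L[ℂ] H₁} (hA1 : ∀ n, ‖A n‖ ≤ 1)
    {B : Fin 2 → H₂ →L[ℂ] H₂} (hB : ∀ m, IsSelfAdjoint (B m)) (hB1 : ∀ m, ‖B m‖ ≤ 1)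
    {γ : Fin 2 → Fin 2 → ℝ} (hγ : ∀ n m, |γ n m| ≤ 1)
    (hγ' : γ 0 0 * γ 0 1 = -(γ 1 0 * γ 1 1)) {T : K122 H₁ H₂ →L[ℂ] K122 H₁ H₂}
    (hT : IsSource122 ρ T) :
    ‖∑ n, ∑ m, (γ n m : ℂ) * trace (ρ ∘L opTensor (A n) (B m))‖ ≤ 2 * traceNorm T := by
  have hV : IsInsertion fun i => tensorRight (HTensor H₁ H₂) (basis H₂ i) :=
    isInsertion_tensorRight (basis H₂)
  have hW : IsInsertion fun i => opTensor (tensorRight H₁ (basis H₂ i)) (.id ℂ H₂) :=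
    (isInsertion_tensorRight (basis H₂)).opTensor_id_right
  have hVT : sliceSum (fun i => tensorRight (HTensor H₁ H₂) (basis H₂ i)) T = ρ :=
    hT.ptrace_third
  have hWT : sliceSum (fun i => opTensor (tensorRight H₁ (basis H₂ i)) (.id ℂ H₂)) T = ρ :=
    hT.ptrace_second
  let a : Fin 2 → K122 H₁ H₂ →L[ℂ] K122 H₁ H₂ := fun n =>
    opTensor (opTensor (A n) (.id ℂ H₂)) (.id ℂ H₂)
  -- `B 0` acts on the second factor, where it survives tracing out the third; `B 1` acts on the
  -- third and survives tracing out the second. Hence they commute even if `B 0` and `B 1` do not.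
  let X : K122 H₁ H₂ →L[ℂ] K122 H₁ H₂ := opTensor (opTensor (.id ℂ H₁) (B 0)) (.id ℂ H₂)
  let Y : K122 H₁ H₂ →L[ℂ] K122 H₁ H₂ := opTensor (.id ℂ (HTensor H₁ H₂)) (B 1)
  have ha (n) : ‖a n‖ ≤ 1 :=
    norm_opTensor_le_one (norm_opTensor_le_one (hA1 n) norm_id_le_one) norm_id_le_one
  have hX : IsSelfAdjoint X :=
    isSelfAdjoint_opTensor (isSelfAdjoint_opTensor isSelfAdjoint_id (hB 0)) isSelfAdjoint_id
  have hY : IsSelfAdjoint Y := isSelfAdjoint_opTensor isSelfAdjoint_id (hB 1)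
  have hX1 : ‖X‖ ≤ 1 :=
    norm_opTensor_le_one (norm_opTensor_le_one norm_id_le_one (hB1 0)) norm_id_le_one
  have hY1 : ‖Y‖ ≤ 1 :=
    norm_opTensor_le_one norm_id_le_one (hB1 1)
  have hXY : Commute X Y := by
    simp [X, Y, Commute, SemiconjBy, ContinuousLinearMap.mul_def, opTensor_comp]
  have haX (n) : Commute (a n) X := by
    simp [a, X, Commute, SemiconjBy, ContinuousLinearMap.mul_def, opTensor_comp]
  have haY (n) : Commute (a n) Y := by
    simp [a, Y, Commute, SemiconjBy, ContinuousLinearMap.mul_def, opTensor_comp]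
  have key := norm_sum_trace_le_of_isInsertion hV hW hρ.ne_zero hT.isSelfAdjoint hT.isTraceClass
    hVT hWT ha hX hY hX1 hY1 hXY haX haY (g := fun n => γ n 0) (h := fun n => γ n 1)
    (fun _ => hγ _ _) (fun _ => hγ _ _) hγ'
    (M := fun n => opTensor (A n) (B 0)) (M' := fun n => opTensor (A n) (B 1))
    (fun n i => by simp [a, X, opTensor_comp, tensorRight_comp])
    (fun n i => by simp [a, Y, opTensor_comp, tensorRight_comp])
  simpa only [Fin.sum_univ_two] using key

theorem norm_sum_trace_le_of_source112 {ρ : HTensor H₁ H₂ →L[ℂ] HTensor H₁ H₂} (hρ : IsState ρ)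
    {A : Fin 2 → H₁ →L[ℂ] H₁} (hA : ∀ n, IsSelfAdjoint (A n)) (hA1 : ∀ n, ‖A n‖ ≤ 1)
    {B : Fin 2 → H₂ →L[ℂ] H₂} (hB1 : ∀ m, ‖B m‖ ≤ 1)
    {γ : Fin 2 → Fin 2 → ℝ} (hγ : ∀ n m, |γ n m| ≤ 1)
    (hγ' : γ 0 0 * γ 1 0 = -(γ 0 1 * γ 1 1)) {T : K112 H₁ H₂ →L[ℂ] K112 H₁ H₂}
    (hT : IsSource112 ρ T) :
    ‖∑ n, ∑ m, (γ n m : ℂ) * trace (ρ ∘L opTensor (A n) (B m))‖ ≤ 2 * traceNorm T := by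
  have hV : IsInsertion fun i => tensorLeft (HTensor H₁ H₂) (basis H₁ i) :=
    isInsertion_tensorLeft (basis H₁)
  have hW : IsInsertion fun i => opTensor (.id ℂ H₁) (tensorLeft H₂ (basis H₁ i)) :=
    (isInsertion_tensorLeft (basis H₁)).opTensor_id_left
  have hVT : sliceSum (fun i => tensorLeft (HTensor H₁ H₂) (basis H₁ i)) T = ρ :=
    hT.ptrace_first
  have hWT : sliceSum (fun i => opTensor (.id ℂ H₁) (tensorLeft H₂ (basis H₁ i))) T = ρ :=
    hT.ptrace_second
  -- The parties exchange roles: `A 0` and `A 1` act on separate copies of `H₁`, and the common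
  -- factors are the `B n`.
  let a : Fin 2 → K112 H₁ H₂ →L[ℂ] K112 H₁ H₂ := fun n =>
    opTensor (.id ℂ H₁) (opTensor (.id ℂ H₁) (B n))
  let X : K112 H₁ H₂ →L[ℂ] K112 H₁ H₂ := opTensor (.id ℂ H₁) (opTensor (A 0) (.id ℂ H₂))
  let Y : K112 H₁ H₂ →L[ℂ] K112 H₁ H₂ := opTensor (A 1) (.id ℂ (HTensor H₁ H₂))
  have ha (n) : ‖a n‖ ≤ 1 :=
    norm_opTensor_le_one norm_id_le_one (norm_opTensor_le_one norm_id_le_one (hB1 n))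
  have hX : IsSelfAdjoint X :=
    isSelfAdjoint_opTensor isSelfAdjoint_id (isSelfAdjoint_opTensor (hA 0) isSelfAdjoint_id)
  have hY : IsSelfAdjoint Y := isSelfAdjoint_opTensor (hA 1) isSelfAdjoint_id
  have hX1 : ‖X‖ ≤ 1 :=
    norm_opTensor_le_one norm_id_le_one (norm_opTensor_le_one (hA1 0) norm_id_le_one)
  have hY1 : ‖Y‖ ≤ 1 :=
    norm_opTensor_le_one (hA1 1) norm_id_le_one
  have hXY : Commute X Y := by
    simp [X, Y, Commute, SemiconjBy, ContinuousLinearMap.mul_def, opTensor_comp]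
  have haX (n) : Commute (a n) X := by
    simp [a, X, Commute, SemiconjBy, ContinuousLinearMap.mul_def, opTensor_comp]
  have haY (n) : Commute (a n) Y := by
    simp [a, Y, Commute, SemiconjBy, ContinuousLinearMap.mul_def, opTensor_comp]
  have key := norm_sum_trace_le_of_isInsertion hV hW hρ.ne_zero hT.isSelfAdjoint hT.isTraceClass
    hVT hWT ha hX hY hX1 hY1 hXY haX haY (g := fun n => γ 0 n) (h := fun n => γ 1 n)
    (fun _ => hγ _ _) (fun _ => hγ _ _) hγ'
    (M := fun n => opTensor (A 0) (B n)) (M' := fun n => opTensor (A 1) (B n))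
    (fun n i => by simp [a, X, opTensor_comp, tensorLeft_comp])
    (fun n i => by simp [a, Y, opTensor_comp, tensorLeft_comp])
  rw [Finset.sum_comm]
  simpa only [Fin.sum_univ_two] using key

end SourceOperators

end Bipartite

end

theorem proposition4
    {H₁ H₂ : Type*}
    [NormedAddCommGroup H₁] [InnerProductSpace ℂ H₁] [CompleteSpace H₁]
    [TopologicalSpace.SeparableSpace H₁]
    [NormedAddCommGroup H₂] [InnerProductSpace ℂ H₂] [CompleteSpace H₂]
    [TopologicalSpace.SeparableSpace H₂]
    (ρ : Bipartite.HTensor H₁ H₂ →L[ℂ] Bipartite.HTensor H₁ H₂) (hρ : Bipartite.IsState ρ)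
    (A : Fin 2 → H₁ →L[ℂ] H₁) (hA : ∀ n, IsSelfAdjoint (A n)) (hA_norm : ∀ n, ‖A n‖ ≤ 1)
    (B : Fin 2 → H₂ →L[ℂ] H₂) (hB : ∀ m, IsSelfAdjoint (B m)) (hB_norm : ∀ m, ‖B m‖ ≤ 1)
    (γ : Fin 2 → Fin 2 → ℝ) (hγ : ∀ n m, |γ n m| ≤ 1) :
    (γ 0 0 * γ 0 1 = -(γ 1 0 * γ 1 1) →
      ∀ T₁₂₂ : Bipartite.K122 H₁ H₂ →L[ℂ] Bipartite.K122 H₁ H₂, Bipartite.IsSource122 ρ T₁₂₂ →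
        ‖∑ n, ∑ m, (γ n m : ℂ) * Bipartite.trace (ρ ∘L Bipartite.opTensor (A n) (B m))‖
          ≤ 2 * Bipartite.traceNorm T₁₂₂) ∧
    (γ 0 0 * γ 1 0 = -(γ 0 1 * γ 1 1) →
      ∀ T₁₁₂ : Bipartite.K112 H₁ H₂ →L[ℂ] Bipartite.K112 H₁ H₂, Bipartite.IsSource112 ρ T₁₁₂ →
        ‖∑ n, ∑ m, (γ n m : ℂ) * Bipartite.trace (ρ ∘L Bipartite.opTensor (A n) (B m))‖
          ≤ 2 * Bipartite.traceNorm T₁₁₂) := by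
  exact ⟨fun h _ hT => Bipartite.norm_sum_trace_le_of_source122 hρ hA_norm hB hB_norm hγ h hT,
    fun h _ hT => Bipartite.norm_sum_trace_le_of_source112 hρ hA hA_norm hB_norm hγ h hT⟩
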